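/- Let $k$ be a field of characteristic zero and let $d\ge n\ge 0$ be integers. Let $U$ be a $k$-vector space with basis $e_1,\dots,e_d,e_\infty$. For $X\subseteq\{1,\dots,n\}$ let $\Gamma_X(d)$ be the set of all maps $\alpha:X\to\{1,\dots,d\}$. For $\alpha\in\Gamma_X(d)$ put $e_\alpha^{\otimes}=e_{\widehat\alpha(1)}\otimes\cdots\otimes e_{\widehat\alpha(n)}\in\otimes^nU$, where $\widehat\alpha(i)=\alpha(i)$ if $i\in X$ and $\widehat\alpha(i)=\infty$ otherwise; these vectors form a basis of $\otimes^n U$. *Extended Schur algebra.* Let $A(d)=k[c_{ij}:1\le i,j\le d]$ be the polynomial bialgebra with $\Delta(c_{ij})=\sum_{l}c_{il}\otimes c_{lj}$ and $\epsilon(c_{ij})=\delta_{ij}$. For $\alpha,\beta\in\Gamma_X(d)$ let $c_{\alpha,\beta}=\prod_{x\in X}c_{\alpha(x),\beta(x)}$, and let $A_{\mathbf n}(d)$ be the subcoalgebra of $A(d)$ spanned by all $c_{\alpha,\beta}$ with $\alpha,\beta\in\Gamma_X(d)$, $X\subseteq\{1,\dots,n\}$. The extended Schur algebra is the dual algebra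 $S_k(d,\mathbf n)=\mathrm{Hom}_k(A_{\mathbf n}(d),k)$. It acts on $\otimes^nU$ on the left by $$\xi\, e_\beta^{\otimes}=\sum_{\alpha\in\Gamma_X(d)}\xi(c_{\alpha,\beta})\,e_\alpha^{\otimes}\qquad(\beta\in\Gamma_X(d),\ X\subseteq\{1,\dots,n\}).$$ *Rook monoid.* Let $R_n$ be the monoid of all injective partial maps from $\{1,\dots,n\}$ to itself, where $\sigma\tau$ means first $\tau$, then $\sigma$, and let $R(\sigma)$ denote the range of $\sigma$. The monoid algebra $kR_n$ acts on $\otimes^nU$ on the right by the linear extension of $$e_\alpha^{\otimes}\cdot\sigma=\begin{cases}e_{\alpha\sigma}^{\otimes}&\text{if }X\subseteq R(\sigma),\\0&\text{otherwise}\end{cases}\qquad(\alpha\in\Gamma_X(d),\ X\subseteq\{1,\dots,n\},\ \sigma\in R_n),$$ where $\alpha\sigma\in\Gamma_{\sigma^{-1}(X)}(d)$ is the composite. **Theorem.** The images of $S_k(d,\mathbf n)$ and of $(kR_n)^{\mathrm{op}}$ in $\mathrm{End}_k(\otimes^nU)$ under these two actions are the full centralizers of each other. Moreover, the two representations are injective,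 so that they induce isomorphisms of $k$-algebras $$S_k(d,\mathbf n)\cong\mathrm{End}_{kR_n}(\otimes^nU)\qquad\text{and}\qquad(kR_n)^{\mathrm{op}}\cong\mathrm{End}_{S_k(d,\mathbf n)}(\otimes^nU).$$ -/

import Mathlib

open scoped TensorProduct

noncomputable section

namespace RookSchur

/-! ### The rook monoid -/

/-- The rook monoid `R_n`: all injective partial maps from an `n`-element set to itself. -/
def RookMonoid (n : ℕ) : Type := Fin n ≃. Fin n

namespace RookMonoid

variable {n : ℕ}

/-- The value of the partial map `σ` at `i` (`none` if `i` is outside the domain). -/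
def app (σ : RookMonoid n) (i : Fin n) : Option (Fin n) := (show Fin n ≃. Fin n from σ) i

/-- The product `σ * τ` is composition of partial maps: first apply `τ`, then `σ`. -/
instance : Monoid (RookMonoid n) where
  one := PEquiv.refl (Fin n)
  mul σ τ := PEquiv.trans τ σ
  mul_assoc σ τ υ := (PEquiv.trans_assoc υ τ σ).symm
  one_mul σ := PEquiv.trans_refl σ
  mul_one σ := PEquiv.refl_trans σ

theorem one_app (i : Fin n) : (1 : RookMonoid n).app i = some i := rfl

theorem mul_app (σ τ : RookMonoid n) (i : Fin n) : (σ * τ).app i = (τ.app i).bind σ.app := rfl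

theorem app_inj (σ : RookMonoid n) {i j m : Fin n} (hi : σ.app i = some m)
    (hj : σ.app j = some m) : i = j :=
  PEquiv.inj (show Fin n ≃. Fin n from σ) hi hj

/-- The range `R(σ)`. -/
def range (σ : RookMonoid n) : Finset (Fin n) := {j | ∃ i, σ.app i = some j}

/-- The preimage `σ⁻¹(X)`, that is, the domain of `α ∘ σ` for a map `α` with domain `X`. -/
def preimage (σ : RookMonoid n) (X : Finset (Fin n)) : Finset (Fin n) :=
  {i | ∃ j ∈ X, σ.app i = some j}

theorem isSome_of_mem_preimage {σ : RookMonoid n} {X : Finset (Fin n)} {i : Fin n}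
    (h : i ∈ σ.preimage X) : (σ.app i).isSome := by
  obtain ⟨j, -, hj⟩ := (Finset.mem_filter.1 h).2
  simp [hj]

theorem get_mem_of_mem_preimage {σ : RookMonoid n} {X : Finset (Fin n)} {i : Fin n}
    (h : i ∈ σ.preimage X) : (σ.app i).get (isSome_of_mem_preimage h) ∈ X := by
  obtain ⟨j, hjX, hj⟩ := (Finset.mem_filter.1 h).2
  simpa [hj] using hjX

/-- The composite `α ∘ σ`, a map on `σ⁻¹(X)`, for `α : X → {1, …, d}`. -/
def comp {d : ℕ} {X : Finset (Fin n)} (α : X → Fin d) (σ : RookMonoid n) :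
    σ.preimage X → Fin d :=
  fun i => α ⟨(σ.app i).get (isSome_of_mem_preimage i.2), get_mem_of_mem_preimage i.2⟩

end RookMonoid

/-! ### The coalgebra `A_n(d)` -/

section Coeff

variable (k : Type*) [Field k] (d n : ℕ)

/-- The comultiplication of the polynomial bialgebra `A(d) = k[c_{ij} : 1 ≤ i, j ≤ d]`,
the algebra map with `Δ(c_{ij}) = ∑_l c_{il} ⊗ c_{lj}`. -/
def polyComul : MvPolynomial (Fin d × Fin d) k →ₐ[k]
    MvPolynomial (Fin d × Fin d) k ⊗[k] MvPolynomial (Fin d × Fin d) k :=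
  MvPolynomial.aeval fun p => ∑ l : Fin d, MvPolynomial.X (p.1, l) ⊗ₜ[k] MvPolynomial.X (l, p.2)

/-- The counit of `A(d)`, the algebra map with `ε(c_{ij}) = δ_{ij}`. -/
def polyCounit : MvPolynomial (Fin d × Fin d) k →ₐ[k] k :=
  MvPolynomial.aeval fun p => if p.1 = p.2 then 1 else 0

variable {d n}

/-- The monomial `c_{α,β} = ∏_{x ∈ X} c_{α(x),β(x)}` for `α, β : X → {1, …, d}`. -/
def mono {X : Finset (Fin n)} (α β : X → Fin d) : MvPolynomial (Fin d × Fin d) k :=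
  ∏ x : X, MvPolynomial.X (α x, β x)

variable (d n)

/-- `A_n(d)`: the span of all monomials `c_{α,β}` with `α, β : X → {1, …, d}` and
`X ⊆ {1, …, n}`. -/
def CoeffSpace : Submodule k (MvPolynomial (Fin d × Fin d) k) :=
  Submodule.span k {p | ∃ (X : Finset (Fin n)) (α β : X → Fin d), p = mono k α β}

variable {d n}

/-- The monomial `c_{α,β}` as an element of `A_n(d)`. -/
def coeff {X : Finset (Fin n)} (α β : X → Fin d) : CoeffSpace k d n :=
  ⟨mono k α β, Submodule.subset_span ⟨X, α, β, rfl⟩⟩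

theorem prod_tmul_prod {ι A : Type*} [CommRing A] [Algebra k A] (s : Finset ι) (f g : ι → A) :
    (∏ i ∈ s, f i) ⊗ₜ[k] (∏ i ∈ s, g i) = ∏ i ∈ s, f i ⊗ₜ[k] g i := by
  classical
  induction s using Finset.induction_on with
  | empty => simp [Algebra.TensorProduct.one_def]
  | insert a s ha ih => simp [Finset.prod_insert ha, ← ih]

theorem polyComul_mono {X : Finset (Fin n)} (α β : X → Fin d) :
    polyComul k d (mono k α β) = ∑ γ : X → Fin d, mono k α γ ⊗ₜ[k] mono k γ β := by
  classical
  simp only [mono, polyComul, map_prod, MvPolynomial.aeval_X, Finset.prod_univ_sum,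
    Fintype.piFinset_univ]
  refine Finset.sum_congr rfl fun γ _ => ?_
  exact (prod_tmul_prod k Finset.univ _ _).symm

theorem polyCounit_mono {X : Finset (Fin n)} (α β : X → Fin d) :
    polyCounit k d (mono k α β) = if α = β then 1 else 0 := by
  classical
  simp only [mono, polyCounit, map_prod, MvPolynomial.aeval_X]
  rw [Fintype.prod_ite_zero]
  simp [funext_iff]

/-- Linear maps on `A_n(d)` are determined by their values on the monomials. -/
theorem coeffSpace_hom_ext {M : Type*} [AddCommMonoid M] [Module k M]
    {f g : CoeffSpace k d n →ₗ[k] M}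
    (h : ∀ (X : Finset (Fin n)) (α β : X → Fin d), f (coeff k α β) = g (coeff k α β)) :
    f = g := by
  refine LinearMap.ext fun x => ?_
  obtain ⟨x, hx⟩ := x
  induction hx using Submodule.span_induction with
  | mem x hx =>
    obtain ⟨X, α, β, rfl⟩ := hx
    exact h X α β
  | zero => exact (map_zero f).trans (map_zero g).symm
  | add x y hx hy ihx ihy =>
    exact (map_add f ⟨x, hx⟩ ⟨y, hy⟩).trans ((congrArg₂ (· + ·) ihx ihy).trans
      (map_add g ⟨x, hx⟩ ⟨y, hy⟩).symm)
  | smul a x hx ih =>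
    exact (map_smul f a ⟨x, hx⟩).trans ((congrArg (a • ·) ih).trans
      (map_smul g a ⟨x, hx⟩).symm)

variable (d n)

/-- The natural map `A_n(d) ⊗ A_n(d) → A(d) ⊗ A(d)`. -/
def inclTensor : CoeffSpace k d n ⊗[k] CoeffSpace k d n →ₗ[k]
    MvPolynomial (Fin d × Fin d) k ⊗[k] MvPolynomial (Fin d × Fin d) k :=
  TensorProduct.map (CoeffSpace k d n).subtype (CoeffSpace k d n).subtype

theorem inclTensor_injective : Function.Injective (inclTensor k d n) :=
  TensorProduct.map_injective_of_flat_flat _ _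
    (Submodule.subtype_injective _) (Submodule.subtype_injective _)

theorem polyComul_mem (x : CoeffSpace k d n) :
    polyComul k d x ∈ LinearMap.range (inclTensor k d n) := by
  obtain ⟨x, hx⟩ := x
  induction hx using Submodule.span_induction with
  | mem x hx =>
    obtain ⟨X, α, β, rfl⟩ := hx
    refine ⟨∑ γ : X → Fin d, coeff k α γ ⊗ₜ[k] coeff k γ β, ?_⟩
    simp only [map_sum]
    exact (polyComul_mono k α β).symm
  | zero => simp
  | add x y hx hy ihx ihy => simpa using Submodule.add_mem _ ihx ihy
  | smul a x hx ih => simpa using Submodule.smul_mem _ a ih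

/-- `A_n(d)` is a subcoalgebra of `A(d)`: its comultiplication is the restriction of that of
`A(d)` (which takes values in `A_n(d) ⊗ A_n(d)`), and its counit is the restriction of that of
`A(d)`. -/
instance : CoalgebraStruct k (CoeffSpace k d n) where
  comul := (LinearEquiv.ofInjective (inclTensor k d n) (inclTensor_injective k d n)).symm ∘ₗ
    LinearMap.codRestrict (LinearMap.range (inclTensor k d n))
      ((polyComul k d).toLinearMap ∘ₗ (CoeffSpace k d n).subtype) (polyComul_mem k d n)
  counit := (polyCounit k d).toLinearMap ∘ₗ (CoeffSpace k d n).subtype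

theorem inclTensor_comul (x : CoeffSpace k d n) :
    inclTensor k d n (Coalgebra.comul x) = polyComul k d x :=
  congrArg Subtype.val (LinearEquiv.apply_symm_apply
    (LinearEquiv.ofInjective (inclTensor k d n) (inclTensor_injective k d n))
    ⟨polyComul k d x, polyComul_mem k d n x⟩)

variable {d n}

theorem comul_coeff {X : Finset (Fin n)} (α β : X → Fin d) :
    Coalgebra.comul (R := k) (coeff k α β) =
      ∑ γ : X → Fin d, coeff k α γ ⊗ₜ[k] coeff k γ β := by
  apply inclTensor_injective
  rw [inclTensor_comul, map_sum]
  exact polyComul_mono k α β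

theorem counit_coeff {X : Finset (Fin n)} (α β : X → Fin d) :
    Coalgebra.counit (R := k) (coeff k α β) = if α = β then 1 else 0 :=
  polyCounit_mono k α β

instance : Coalgebra k (CoeffSpace k d n) where
  coassoc := by
    refine coeffSpace_hom_ext k fun X α β => ?_
    simp only [LinearMap.comp_apply, LinearEquiv.coe_coe, comul_coeff, map_sum,
      LinearMap.rTensor_tmul, LinearMap.lTensor_tmul, TensorProduct.sum_tmul,
      TensorProduct.tmul_sum, TensorProduct.assoc_tmul]
    exact Finset.sum_comm
  rTensor_counit_comp_comul := by
    refine coeffSpace_hom_ext k fun X α β => ?_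
    simp [comul_coeff, counit_coeff, TensorProduct.ite_tmul]
  lTensor_counit_comp_comul := by
    refine coeffSpace_hom_ext k fun X α β => ?_
    simp [comul_coeff, counit_coeff, TensorProduct.tmul_ite]

variable (d n)

/-- The extended Schur algebra `S_k(d, n) = Hom_k(A_n(d), k)`: the linear dual of the coalgebra
`A_n(d)` with the dual algebra structure, `(ξ η)(c) = (ξ ⊗ η)(Δ c)` and unit `ε`. -/
abbrev ExtSchurAlgebra : Type _ := WithConv (CoeffSpace k d n →ₗ[k] k)

variable {d n}

theorem mul_coeff (ξ η : ExtSchurAlgebra k d n) {X : Finset (Fin n)} (α β : X → Fin d) :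
    (ξ * η) (coeff k α β) = ∑ γ : X → Fin d, ξ (coeff k α γ) * η (coeff k γ β) := by
  simp [comul_coeff]

theorem one_coeff {X : Finset (Fin n)} (α β : X → Fin d) :
    (1 : ExtSchurAlgebra k d n) (coeff k α β) = if α = β then 1 else 0 := by
  simp [counit_coeff]

end Coeff

/-! ### Tensor space and its basis -/

section Tensor

variable {d n : ℕ}

/-- The pairs `(X, α)` with `X ⊆ {1, …, n}` and `α : X → {1, …, d}`. -/
abbrev Idx (d n : ℕ) : Type := Σ X : Finset (Fin n), (X → Fin d)

/-- The extension of `α : X → {1, …, d}` to a map `{1, …, n} → {1, …, d} ∪ {∞}` with value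
`∞` (encoded as `none`) outside `X`. -/
def hat (p : Idx d n) (i : Fin n) : Option (Fin d) :=
  if h : i ∈ p.1 then some (p.2 ⟨i, h⟩) else none

theorem hat_isSome (p : Idx d n) (i : Fin n) : (hat p i).isSome ↔ i ∈ p.1 := by
  unfold hat
  split_ifs with h <;> simp [h]

theorem hat_injective : Function.Injective (hat (d := d) (n := n)) := by
  rintro ⟨X, α⟩ ⟨Y, β⟩ h
  obtain rfl : X = Y := by
    ext i
    rw [← hat_isSome ⟨X, α⟩ i, h, hat_isSome]
  congr 1
  funext i
  have := congrFun h i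
  simpa [hat] using this

theorem hat_surjective : Function.Surjective (hat (d := d) (n := n)) := by
  intro f
  refine ⟨⟨Finset.univ.filter fun i => (f i).isSome,
    fun i => (f i).get (Finset.mem_filter.1 i.2).2⟩, funext fun i => ?_⟩
  by_cases h : (f i).isSome
  · simp [hat, h]
  · simp only [hat, Finset.mem_filter, Finset.mem_univ, true_and, h]
    simpa using (Option.not_isSome_iff_eq_none.1 h).symm

variable {k : Type*} [Field k] {U : Type*} [AddCommGroup U] [Module k U]
  (e : Module.Basis (Option (Fin d)) k U)

variable (n) in
/-- The basis `e_α^⊗ = e_{α̂(1)} ⊗ ⋯ ⊗ e_{α̂(n)}` of the `n`-th tensor power of `U`, indexed by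
the maps `α : X → {1, …, d}`, `X ⊆ {1, …, n}`.  Here `e (some i)` is the basis vector `e_i` of `V`
and `e none` is `e_∞`. -/
def tensorBasis : Module.Basis (Idx d n) k (⨂[k]^n U) :=
  (Basis.piTensorProduct fun _ : Fin n => e).reindex
    (Equiv.ofBijective hat ⟨hat_injective, hat_surjective⟩).symm

theorem tensorBasis_apply (p : Idx d n) :
    tensorBasis n e p = PiTensorProduct.tprod k fun i => e (hat p i) := by
  rw [tensorBasis, Module.Basis.reindex_apply, Basis.piTensorProduct_apply]
  rfl

/-! ### The left action of the extended Schur algebra -/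

/-- The operator `e_β^⊗ ↦ ∑_{α : X → {1, …, d}} ξ(c_{α,β}) e_α^⊗`, for `β : X → {1, …, d}`. -/
def schurOp (ξ : ExtSchurAlgebra k d n) : Module.End k (⨂[k]^n U) :=
  (tensorBasis n e).constr k fun q =>
    ∑ α : q.1 → Fin d, ξ (coeff k α q.2) • tensorBasis n e ⟨q.1, α⟩

theorem schurOp_basis (ξ : ExtSchurAlgebra k d n) (X : Finset (Fin n)) (β : X → Fin d) :
    schurOp e ξ (tensorBasis n e ⟨X, β⟩) =
      ∑ α : X → Fin d, ξ (coeff k α β) • tensorBasis n e ⟨X, α⟩ :=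
  Module.Basis.constr_basis _ _ _ _

variable (n) in
/-- The left action of the extended Schur algebra on the `n`-th tensor power of `U`. -/
def schurRep : ExtSchurAlgebra k d n →ₐ[k] Module.End k (⨂[k]^n U) :=
  AlgHom.ofLinearMap
    { toFun := schurOp e
      map_add' := fun ξ η => (tensorBasis n e).ext fun ⟨X, β⟩ => by
        simp [schurOp_basis, add_smul, Finset.sum_add_distrib]
      map_smul' := fun a ξ => (tensorBasis n e).ext fun ⟨X, β⟩ => by
        simp [schurOp_basis, mul_smul, Finset.smul_sum] }
    ((tensorBasis n e).ext fun ⟨X, β⟩ => by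
      simp only [LinearMap.coe_mk, AddHom.coe_mk, schurOp_basis, one_coeff, ite_smul, one_smul,
        zero_smul, Module.End.one_apply]
      simp)
    (fun ξ η => (tensorBasis n e).ext fun ⟨X, β⟩ => by
      simp only [LinearMap.coe_mk, AddHom.coe_mk, schurOp_basis, mul_coeff, Module.End.mul_apply,
        map_sum, map_smul, Finset.smul_sum, Finset.sum_smul, smul_smul]
      rw [Finset.sum_comm]
      simp only [mul_comm])

theorem schurRep_basis (ξ : ExtSchurAlgebra k d n) (X : Finset (Fin n)) (β : X → Fin d) :
    schurRep n e ξ (tensorBasis n e ⟨X, β⟩) =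
      ∑ α : X → Fin d, ξ (coeff k α β) • tensorBasis n e ⟨X, α⟩ :=
  schurOp_basis e ξ X β

/-! ### The right action of the rook monoid -/

/-- The operator `e_α^⊗ ↦ e_α^⊗ · σ`, which is `e_{α ∘ σ}^⊗` if `X ⊆ R(σ)`, and `0`
otherwise, for `α : X → {1, …, d}`. -/
def rookOp (σ : RookMonoid n) : Module.End k (⨂[k]^n U) :=
  (tensorBasis n e).constr k fun q =>
    if q.1 ⊆ σ.range then tensorBasis n e ⟨σ.preimage q.1, RookMonoid.comp q.2 σ⟩ else 0

theorem rookOp_basis (σ : RookMonoid n) (X : Finset (Fin n)) (α : X → Fin d) :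
    rookOp e σ (tensorBasis n e ⟨X, α⟩) =
      if X ⊆ σ.range then tensorBasis n e ⟨σ.preimage X, RookMonoid.comp α σ⟩ else 0 :=
  Module.Basis.constr_basis _ _ _ _

theorem hat_comp (σ : RookMonoid n) (X : Finset (Fin n)) (α : X → Fin d) (i : Fin n) :
    hat ⟨σ.preimage X, RookMonoid.comp α σ⟩ i = (σ.app i).bind (hat ⟨X, α⟩) := by
  rcases h : σ.app i with _ | j
  · simp [hat, RookMonoid.preimage, h]
  · by_cases hj : j ∈ X <;> simp [hat, RookMonoid.preimage, RookMonoid.comp, h, hj]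

theorem rookOp_one : rookOp e (1 : RookMonoid n) = 1 := by
  refine (tensorBasis n e).ext fun ⟨X, α⟩ => ?_
  have hX : X ⊆ (1 : RookMonoid n).range := fun i _ => by
    simp [RookMonoid.range, RookMonoid.one_app]
  rw [rookOp_basis, if_pos hX, Module.End.one_apply]
  congr 1
  apply hat_injective
  funext i
  rw [hat_comp, RookMonoid.one_app, Option.bind_some]

theorem rookOp_mul (σ τ : RookMonoid n) : rookOp e (σ * τ) = rookOp e τ * rookOp e σ := by
  refine (tensorBasis n e).ext fun ⟨X, α⟩ => ?_
  have hiff : X ⊆ (σ * τ).range ↔ X ⊆ σ.range ∧ σ.preimage X ⊆ τ.range := by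
    simp only [Finset.subset_iff, RookMonoid.range, RookMonoid.preimage, Finset.mem_filter,
      Finset.mem_univ, true_and, RookMonoid.mul_app, Option.bind_eq_some_iff]
    constructor
    · intro h
      refine ⟨fun j hj => ?_, ?_⟩
      · obtain ⟨i, m, -, hm⟩ := h hj
        exact ⟨m, hm⟩
      · rintro l ⟨j, hj, hl⟩
        obtain ⟨i, m, hi, hm⟩ := h hj
        obtain rfl := σ.app_inj hl hm
        exact ⟨i, hi⟩
    · rintro ⟨h1, h2⟩ j hj
      obtain ⟨m, hm⟩ := h1 hj
      obtain ⟨i, hi⟩ := h2 ⟨j, hj, hm⟩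
      exact ⟨i, m, hi, hm⟩
  rw [Module.End.mul_apply, rookOp_basis, rookOp_basis]
  by_cases h1 : X ⊆ σ.range
  · rw [if_pos h1, rookOp_basis]
    by_cases h2 : σ.preimage X ⊆ τ.range
    · rw [if_pos (hiff.2 ⟨h1, h2⟩), if_pos h2]
      congr 1
      apply hat_injective
      funext i
      rw [hat_comp, hat_comp, RookMonoid.mul_app]
      rcases τ.app i with _ | j
      · rfl
      · simp [hat_comp]
    · rw [if_neg fun h => h2 (hiff.1 h).2, if_neg h2]
  · rw [if_neg fun h => h1 (hiff.1 h).1, if_neg h1, map_zero]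

variable (n) in
/-- The right action of the monoid algebra `k R_n` on the `n`-th tensor power of `U`, as a
representation of the opposite algebra: the linear extension of `σ ↦ (z ↦ z · σ)`. -/
def rookRep : (MonoidAlgebra k (RookMonoid n))ᵐᵒᵖ →ₐ[k] Module.End k (⨂[k]^n U) :=
  AlgHom.opComm (MonoidAlgebra.lift k (Module.End k (⨂[k]^n U))ᵐᵒᵖ (RookMonoid n)
    { toFun := fun σ => MulOpposite.op (rookOp e σ)
      map_one' := congrArg MulOpposite.op (rookOp_one e)
      map_mul' := fun σ τ => congrArg MulOpposite.op (rookOp_mul e σ τ) })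

theorem rookRep_basis (σ : RookMonoid n) (X : Finset (Fin n)) (α : X → Fin d) :
    rookRep n e (MulOpposite.op (MonoidAlgebra.of k (RookMonoid n) σ))
        (tensorBasis n e ⟨X, α⟩) =
      if X ⊆ σ.range then tensorBasis n e ⟨σ.preimage X, RookMonoid.comp α σ⟩ else 0 := by
  rw [← rookOp_basis]
  simp [rookRep]

end Tensor

/-- The centralizer algebra `End_A(M) = {φ ∈ End_k(M) : φ ρ(a) = ρ(a) φ for all a ∈ A}` of a
representation `ρ : A → End_k(M)`. -/
abbrev centralizerAlgebra {k A M : Type*} [Field k] [Semiring A] [Algebra k A] [AddCommGroup M]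
    [Module k M] (ρ : A →ₐ[k] Module.End k M) : Subalgebra k (Module.End k M) :=
  Subalgebra.centralizer k (Set.range ρ)

end RookSchur

end

/-!
The tensor space splits into blocks, one for each `X ⊆ {1, …, n}`, spanned by the `e_α^⊗` with
`α : X → {1, …, d}`. Both halves of the duality rest on one fact (`exists_equiv_of_expo_eq`): the
monomials `c_{α,β}` and `c_{γ,δ}` agree exactly when a bijection between the domains carries
`(α, β)` to `(γ, δ)`, and such a bijection is an element of the rook monoid.

The projection onto each block lies in the image of `k R_n` (`blockProj_mem_range`). Hence an
operator commuting with `R_n` is block diagonal, and its matrix entries are invariant under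
bijections between domains (`repr_comp_equiv`), so they are functions of the monomials. As distinct
monomials are linearly independent, the operator comes from the extended Schur algebra
(`mem_range_schurRep`). An element of that algebra is recovered from the entries of its operator,
which gives injectivity.

For the other half, `n ≤ d` provides an injective `β : X → {1, …, d}` for each `X`, and `e_β^⊗`
generates its block over the extended Schur algebra (`schurRep_ofExpo_single`). An operator `T`
commuting with that algebra is therefore determined by the vectors `T e_β^⊗`. Preservation of
weights forces `T e_β^⊗` to be a combination of the `e_β^⊗ · σ` with `R(σ) = X`
(`exists_comp_eq_of_repr_ne_zero`), and composing each `σ` with the block projection of its range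
realizes all these combinations at once in the image of `k R_n` (`mem_range_rookRep`). These
`e_β^⊗ · σ` are distinct basis vectors for distinct `σ`; looking at an element of maximal range in
the support shows that `k R_n` acts faithfully (`rookRep_injective`).
-/

namespace RookSchur

/-! ### Partial bijections -/

/-- Two finite families with the same multiset of values differ by a bijection of their index
types. -/
theorem exists_equiv_of_sum_single_eq {X Y C : Type*} [Fintype X] [Fintype Y] {f : X → C}
    {g : Y → C} (h : ∑ x, Finsupp.single (f x) 1 = ∑ y, Finsupp.single (g y) 1) :
    ∃ E : Y ≃ X, ∀ y, f (E y) = g y := by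
  classical
  have hcard : ∀ c, Fintype.card {y // g y = c} = Fintype.card {x // f x = c} := fun c => by
    have := DFunLike.congr_fun h c
    simp only [Finsupp.finsetSum_apply, Finsupp.single_apply, Finset.sum_boole] at this
    simpa [Fintype.card_subtype] using this.symm
  refine ⟨(Equiv.sigmaFiberEquiv g).symm.trans <|
    (Equiv.sigmaCongrRight fun c => Fintype.equivOfCardEq (hcard c)).trans
      (Equiv.sigmaFiberEquiv f), fun y => ?_⟩
  exact (Fintype.equivOfCardEq (hcard (g y)) ⟨y, rfl⟩).2

namespace RookMonoid

variable {n d : ℕ}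

theorem ext_app {σ τ : RookMonoid n} (h : ∀ i, σ.app i = τ.app i) : σ = τ :=
  PEquiv.ext h

instance : Finite (RookMonoid n) :=
  Finite.of_injective app fun _ _ h => ext_app (congrFun h)

/-- The element of the rook monoid with domain `Y` and range `X` given by a bijection `Y ≃ X`. -/
def ofEquiv {X Y : Finset (Fin n)} (E : Y ≃ X) : RookMonoid n where
  toFun i := if h : i ∈ Y then some (E ⟨i, h⟩) else none
  invFun j := if h : j ∈ X then some (E.symm ⟨j, h⟩) else none
  inv i j := by
    simp only [Option.dite_none_right_eq_some, Option.some.injEq]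
    constructor
    · rintro ⟨h, rfl⟩
      exact ⟨Subtype.coe_prop _, by simp⟩
    · rintro ⟨h, rfl⟩
      exact ⟨Subtype.coe_prop _, by simp⟩

theorem ofEquiv_app {X Y : Finset (Fin n)} (E : Y ≃ X) (i : Fin n) :
    (ofEquiv E).app i = if h : i ∈ Y then some (E ⟨i, h⟩ : Fin n) else none := rfl

theorem range_ofEquiv {X Y : Finset (Fin n)} (E : Y ≃ X) : (ofEquiv E).range = X := by
  ext j
  simp only [range, Finset.mem_filter, Finset.mem_univ, true_and, ofEquiv_app,
    Option.dite_none_right_eq_some, Option.some.injEq]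
  constructor
  · rintro ⟨i, h, rfl⟩
    exact Subtype.coe_prop _
  · exact fun h => ⟨E.symm ⟨j, h⟩, Subtype.coe_prop _, by simp⟩

theorem comp_ofEquiv {X Y : Finset (Fin n)} (E : Y ≃ X) (α : X → Fin d) :
    (⟨(ofEquiv E).preimage X, comp α (ofEquiv E)⟩ : Idx d n) = ⟨Y, α ∘ E⟩ := by
  apply hat_injective
  funext i
  rw [hat_comp, ofEquiv_app]
  by_cases h : i ∈ Y <;> simp [hat, h]

/-- For `X` contained in the range of `σ`, the bijection `σ⁻¹(X) ≃ X` induced by `σ`. -/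
noncomputable def preimageEquiv (σ : RookMonoid n) {X : Finset (Fin n)} (hX : X ⊆ σ.range) :
    σ.preimage X ≃ X :=
  Equiv.ofBijective
    (fun i => ⟨(σ.app i).get (isSome_of_mem_preimage i.2), get_mem_of_mem_preimage i.2⟩) <| by
    constructor
    · intro i j h
      have h : (σ.app i).get _ = (σ.app j).get _ := Subtype.ext_iff.1 h
      have hi := Option.some_get (isSome_of_mem_preimage i.2)
      have hj := Option.some_get (isSome_of_mem_preimage j.2)
      rw [h] at hi
      exact Subtype.ext (σ.app_inj hi.symm hj.symm)
    · rintro ⟨j, hj⟩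
      obtain ⟨i, hi⟩ := (Finset.mem_filter.1 (hX hj)).2
      exact ⟨⟨i, by simp [preimage, hi, hj]⟩, by simp [hi]⟩

theorem comp_eq (σ : RookMonoid n) {X : Finset (Fin n)} (hX : X ⊆ σ.range) (α : X → Fin d) :
    comp α σ = α ∘ σ.preimageEquiv hX := rfl

/-- Precomposition with `σ` is injective on maps defined inside the range of `σ`. -/
theorem idx_comp_injective (σ : RookMonoid n) {p q : Idx d n} (hp : p.1 ⊆ σ.range)
    (hq : q.1 ⊆ σ.range)
    (h : (⟨σ.preimage p.1, comp p.2 σ⟩ : Idx d n) = ⟨σ.preimage q.1, comp q.2 σ⟩) :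
    p = q := by
  apply hat_injective
  funext j
  by_cases hj : j ∈ σ.range
  · obtain ⟨i, hi⟩ := (Finset.mem_filter.1 hj).2
    have := congrFun (congrArg hat h) i
    simpa [hat_comp, hi] using this
  · simp [hat, mt (@hp _) hj, mt (@hq _) hj]

/-- An element of range `X` is determined by its composite with an injective map on `X`. -/
theorem eq_of_comp_eq {X : Finset (Fin n)} {β : X → Fin d} (hβ : Function.Injective β)
    {σ τ : RookMonoid n} (hσ : σ.range = X) (hτ : τ.range = X)
    (h : (⟨σ.preimage X, comp β σ⟩ : Idx d n) = ⟨τ.preimage X, comp β τ⟩) : σ = τ := by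
  refine ext_app fun i => ?_
  have hi := congrFun (congrArg hat h) i
  simp only [hat_comp] at hi
  have key : ∀ υ : RookMonoid n, υ.range = X → ∀ j, υ.app i = some j → j ∈ X := by
    rintro υ rfl j hj
    simpa [range] using ⟨i, hj⟩
  rcases h1 : σ.app i with _ | a <;> rcases h2 : τ.app i with _ | b
  · rfl
  · simp [h1, h2, hat, key τ hτ b h2] at hi
  · simp [h1, h2, hat, key σ hσ a h1] at hi
  · simpa [h1, h2, hat, key τ hτ b h2, key σ hσ a h1, hβ.eq_iff] using hi

end RookMonoid

/-! ### Functionals on the coalgebra -/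

section Coeff

variable {k : Type*} [Field k] {d n : ℕ}

/-- The exponent vector of the monomial `c_{α,β}`. -/
noncomputable def expo {X : Finset (Fin n)} (α β : X → Fin d) : Fin d × Fin d →₀ ℕ :=
  ∑ x, Finsupp.single (α x, β x) 1

theorem mono_eq_monomial {X : Finset (Fin n)} (α β : X → Fin d) :
    mono k α β = MvPolynomial.monomial (expo α β) 1 := by
  rw [expo, MvPolynomial.monomial_sum_one]
  rfl

theorem expo_comp_equiv {X Y : Finset (Fin n)} (E : Y ≃ X) (α β : X → Fin d) :
    expo (α ∘ E) (β ∘ E) = expo α β :=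
  Equiv.sum_comp E fun x => Finsupp.single (α x, β x) 1

/-- Two monomials coincide only if the pairs of maps defining them differ by a bijection between
their domains. -/
theorem exists_equiv_of_expo_eq {X Y : Finset (Fin n)} {α β : X → Fin d} {γ δ : Y → Fin d}
    (h : expo α β = expo γ δ) : ∃ E : Y ≃ X, α ∘ E = γ ∧ β ∘ E = δ := by
  obtain ⟨E, hE⟩ := exists_equiv_of_sum_single_eq h
  exact ⟨E, funext fun y => (Prod.ext_iff.1 (hE y)).1, funext fun y => (Prod.ext_iff.1 (hE y)).2⟩

variable (k n) in
/-- The element of the extended Schur algebra that sends each monomial to the value of `f` at its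
exponent vector. -/
noncomputable def ofExpo (f : (Fin d × Fin d →₀ ℕ) → k) : ExtSchurAlgebra k d n :=
  WithConv.toConv
    ((MvPolynomial.basisMonomials (Fin d × Fin d) k).constr k f ∘ₗ (CoeffSpace k d n).subtype)

theorem ofExpo_coeff (f : (Fin d × Fin d →₀ ℕ) → k) {X : Finset (Fin n)} (α β : X → Fin d) :
    ofExpo k n f (coeff k α β) = f (expo α β) := by
  change (MvPolynomial.basisMonomials (Fin d × Fin d) k).constr k f (mono k α β) = _
  rw [mono_eq_monomial]
  exact Module.Basis.constr_basis _ _ _ _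

theorem coeff_comp_equiv {X Y : Finset (Fin n)} (E : Y ≃ X) (α β : X → Fin d) :
    coeff k (α ∘ E) (β ∘ E) = coeff k α β :=
  Subtype.ext <| by
    change mono k _ _ = mono k _ _
    rw [mono_eq_monomial, mono_eq_monomial, expo_comp_equiv]

end Coeff

/-! ### The two actions commute -/

section Tensor

variable {k : Type*} [Field k] {d n : ℕ} {U : Type*} [AddCommGroup U] [Module k U]
  (e : Module.Basis (Option (Fin d)) k U)

theorem rookRep_apply (a : (MonoidAlgebra k (RookMonoid n))ᵐᵒᵖ) :
    rookRep n e a = a.unop.coeff.sum fun σ c => c • rookOp e σ := by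
  simp [rookRep, MonoidAlgebra.lift_apply, Finsupp.sum]

theorem rookRep_of (σ : RookMonoid n) :
    rookRep n e (MulOpposite.op (MonoidAlgebra.of k (RookMonoid n) σ)) = rookOp e σ := by
  simp [rookRep]

theorem rookOp_mem_range (σ : RookMonoid n) : rookOp e σ ∈ (rookRep n e).range :=
  ⟨_, rookRep_of e σ⟩

theorem schurRep_rookOp_comm (ξ : ExtSchurAlgebra k d n) (σ : RookMonoid n) :
    Commute (schurRep n e ξ) (rookOp e σ) := by
  refine (tensorBasis n e).ext fun ⟨X, β⟩ => ?_
  simp only [Module.End.mul_apply, schurRep_basis, map_sum, map_smul, rookOp_basis]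
  by_cases hX : X ⊆ σ.range
  · simp only [if_pos hX, schurRep_basis, RookMonoid.comp_eq σ hX]
    rw [← (Equiv.arrowCongr (σ.preimageEquiv hX).symm (Equiv.refl (Fin d))).sum_comp]
    refine Finset.sum_congr rfl fun α _ => ?_
    change ξ (coeff k (α ∘ σ.preimageEquiv hX) _) • _ = _
    rw [coeff_comp_equiv]
    rfl
  · simp [hX]

theorem schurRep_rookRep_comm (ξ : ExtSchurAlgebra k d n)
    (a : (MonoidAlgebra k (RookMonoid n))ᵐᵒᵖ) : Commute (schurRep n e ξ) (rookRep n e a) := by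
  rw [rookRep_apply]
  exact Commute.sum_right _ _ _ fun σ _ => (schurRep_rookOp_comm e ξ σ).smul_right _

/-! ### Projections onto the blocks of tensor space -/

/-- The projection onto the span of the `e_α^⊗` with `α : X → {1, …, d}` along the other basis
vectors. -/
noncomputable def blockProj (X : Finset (Fin n)) : Module.End k (⨂[k]^n U) :=
  (tensorBasis n e).constr k fun q => if q.1 = X then tensorBasis n e q else 0

theorem blockProj_basis (X : Finset (Fin n)) (q : Idx d n) :
    blockProj e X (tensorBasis n e q) = if q.1 = X then tensorBasis n e q else 0 :=
  Module.Basis.constr_basis _ _ _ _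

/-- The partial identity on `Y` acts as the projection onto the blocks of the subsets of `Y`. -/
theorem rookOp_ofEquiv_refl (Y : Finset (Fin n)) (q : Idx d n) :
    rookOp e (RookMonoid.ofEquiv (Equiv.refl Y)) (tensorBasis n e q) =
      if q.1 ⊆ Y then tensorBasis n e q else 0 := by
  rw [rookOp_basis, RookMonoid.range_ofEquiv]
  split_ifs with h
  · congr 1
    apply hat_injective
    funext i
    rw [hat_comp, RookMonoid.ofEquiv_app]
    by_cases hi : i ∈ Y
    · simp [hi]
    · simp [hi, hat, mt (@h i) hi]
  · rfl

/-- The algebra `k R_n` acts through operators that include the block projections: these are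
products of the partial identities omitting one point and of their complements. -/
theorem blockProj_mem_range (X : Finset (Fin n)) : blockProj e X ∈ (rookRep n e).range := by
  suffices h : ∀ s : Finset (Fin n), ∃ T ∈ (rookRep n e).range, ∀ q : Idx d n,
      T (tensorBasis n e q) =
        if ∀ i ∈ s, (i ∈ q.1 ↔ i ∈ X) then tensorBasis n e q else 0 by
    obtain ⟨T, hT, h⟩ := h Finset.univ
    convert hT using 1
    refine (tensorBasis n e).ext fun q => ?_
    simp [h, blockProj_basis, Finset.ext_iff]
  intro s
  induction s using Finset.induction_on with
  | empty => exact ⟨1, one_mem _, fun q => by simp⟩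
  | insert i s his ih =>
    obtain ⟨T, hT, h⟩ := ih
    -- `f` kills the basis vectors whose index is defined at `i` and fixes the others
    let f : Module.End k (⨂[k]^n U) :=
      rookOp e (RookMonoid.ofEquiv (Equiv.refl ({i}ᶜ : Finset (Fin n))))
    have hf : f ∈ (rookRep n e).range := rookOp_mem_range e _
    have hfq : ∀ q : Idx d n, f (tensorBasis n e q) =
        if i ∈ q.1 then 0 else tensorBasis n e q := fun q => by
      simp [f, rookOp_ofEquiv_refl, ite_not]
    by_cases hi : i ∈ X
    · refine ⟨T * (1 - f), mul_mem hT (sub_mem (one_mem _) hf), fun q => ?_⟩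
      by_cases hq : i ∈ q.1 <;> simp [hfq, h, hi, hq]
    · refine ⟨T * f, mul_mem hT hf, fun q => ?_⟩
      by_cases hq : i ∈ q.1 <;> simp [hfq, h, hi, hq]

/-! ### The centralizer of the rook monoid -/

/-- Coordinate form of the action of `σ`: the coefficient of `e_{α ∘ σ}^⊗` in `v · σ` is that of
`e_α^⊗` in `v`. -/
theorem repr_rookOp (σ : RookMonoid n) (v : ⨂[k]^n U) (p : Idx d n) (hp : p.1 ⊆ σ.range) :
    (tensorBasis n e).repr (rookOp e σ v) ⟨σ.preimage p.1, RookMonoid.comp p.2 σ⟩ =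
      (tensorBasis n e).repr v p := by
  have : (tensorBasis n e).coord ⟨σ.preimage p.1, RookMonoid.comp p.2 σ⟩ ∘ₗ rookOp e σ =
      (tensorBasis n e).coord p := by
    refine (tensorBasis n e).ext fun q => ?_
    rw [LinearMap.comp_apply, rookOp_basis]
    by_cases hq : q.1 ⊆ σ.range
    · by_cases h : q = p
      · subst h
        simp [hq]
      · have h' := mt (σ.idx_comp_injective hq hp) h
        simp [hq, h, h']
    · have h : q ≠ p := by
        rintro rfl
        exact hq hp
      simp [hq, h]
  exact LinearMap.congr_fun this v

/-- The matrix entries of an operator commuting with the rook monoid are invariant under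
bijections between index sets. -/
theorem repr_comp_equiv {T : Module.End k (⨂[k]^n U)} (hT : ∀ σ, Commute T (rookOp e σ))
    {X Y : Finset (Fin n)} (E : Y ≃ X) (α β : X → Fin d) :
    (tensorBasis n e).repr (T (tensorBasis n e ⟨Y, β ∘ E⟩)) ⟨Y, α ∘ E⟩ =
      (tensorBasis n e).repr (T (tensorBasis n e ⟨X, β⟩)) ⟨X, α⟩ := by
  have hX := (RookMonoid.range_ofEquiv E).symm.subset
  rw [← repr_rookOp e (RookMonoid.ofEquiv E) (T _) ⟨X, α⟩ hX, ← Module.End.mul_apply,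
    ← (hT _).eq, Module.End.mul_apply, rookOp_basis, if_pos hX]
  simp only [RookMonoid.comp_ofEquiv]

theorem blockProj_eq_sum (X : Finset (Fin n)) (v : ⨂[k]^n U) :
    blockProj e X v =
      ∑ α : X → Fin d, (tensorBasis n e).repr v ⟨X, α⟩ • tensorBasis n e ⟨X, α⟩ := by
  conv_lhs => rw [← (tensorBasis n e).sum_repr v]
  simp only [map_sum, map_smul, blockProj_basis, Fintype.sum_sigma]
  rw [Finset.sum_eq_single X (fun Y _ hY => by simp [hY]) (by simp)]
  simp

/-- An operator commuting with the rook monoid preserves the blocks, since the block projections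
come from `k R_n`, and its entries depend only on the monomials `c_{α,β}`; extended by zero to all
monomials they define an element of the extended Schur algebra. -/
theorem mem_range_schurRep {T : Module.End k (⨂[k]^n U)}
    (hT : T ∈ centralizerAlgebra (rookRep n e)) : T ∈ (schurRep n e).range := by
  classical
  rw [centralizerAlgebra, Subalgebra.mem_centralizer_iff] at hT
  have hrook : ∀ σ, Commute T (rookOp e σ) := fun σ => (hT _ (rookOp_mem_range e σ)).symm
  have hblock : ∀ X, Commute T (blockProj e X) := fun X => (hT _ (blockProj_mem_range e X)).symm
  let t (z : Σ X : Finset (Fin n), (X → Fin d) × (X → Fin d)) : k :=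
    (tensorBasis n e).repr (T (tensorBasis n e ⟨z.1, z.2.2⟩)) ⟨z.1, z.2.1⟩
  let m (z : Σ X : Finset (Fin n), (X → Fin d) × (X → Fin d)) := expo z.2.1 z.2.2
  have ht : Function.FactorsThrough t m := by
    rintro ⟨X, α, β⟩ ⟨Y, γ, δ⟩ h
    obtain ⟨E, rfl, rfl⟩ : ∃ E : Y ≃ X, α ∘ E = γ ∧ β ∘ E = δ := exists_equiv_of_expo_eq h
    exact (repr_comp_equiv e hrook E α β).symm
  refine ⟨ofExpo k n (Function.extend m t 0), (tensorBasis n e).ext fun ⟨X, β⟩ => ?_⟩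
  have hX : T (tensorBasis n e ⟨X, β⟩) = blockProj e X (T (tensorBasis n e ⟨X, β⟩)) := by
    rw [← Module.End.mul_apply, ← (hblock X).eq, Module.End.mul_apply, blockProj_basis,
      if_pos rfl]
  rw [hX, blockProj_eq_sum]
  refine (schurRep_basis e _ X β).trans (Finset.sum_congr rfl fun α _ => ?_)
  rw [ofExpo_coeff]
  exact congrArg (· • _) (ht.extend_apply 0 ⟨X, α, β⟩)

theorem schurRep_injective : Function.Injective (schurRep n e) := by
  intro ξ η h
  apply WithConv.ofConv_injective
  refine coeffSpace_hom_ext k fun X α β => ?_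
  have := congrArg (fun v => (tensorBasis n e).repr v ⟨X, α⟩)
    (LinearMap.congr_fun h (tensorBasis n e ⟨X, β⟩))
  simpa [schurRep_basis, Finsupp.single_apply] using this

/-! ### The centralizer of the extended Schur algebra -/

/-- The inclusion of `X` into `{1, …, d}`, an injective index. -/
def incl (hnd : n ≤ d) (X : Finset (Fin n)) : X → Fin d :=
  fun x => Fin.castLE hnd x

theorem incl_injective (hnd : n ≤ d) (X : Finset (Fin n)) : Function.Injective (incl hnd X) :=
  (Fin.castLE_injective hnd).comp Subtype.val_injective

/-- The basis vector `e_β^⊗` of an injective index generates its block over the extended Schur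
algebra: the functional dual to `c_{α,β}` sends it to `e_α^⊗`. -/
theorem schurRep_ofExpo_single {X : Finset (Fin n)} {β : X → Fin d}
    (hβ : Function.Injective β) (α : X → Fin d) :
    schurRep n e (ofExpo k n (Pi.single (expo α β) 1)) (tensorBasis n e ⟨X, β⟩) =
      tensorBasis n e ⟨X, α⟩ := by
  classical
  rw [schurRep_basis, Finset.sum_eq_single α]
  · simp [ofExpo_coeff]
  · intro γ _ hγ
    have : expo γ β ≠ expo α β := fun h => hγ <| by
      obtain ⟨E, hE, hE'⟩ := exists_equiv_of_expo_eq h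
      have : ∀ x, E x = x := fun x => hβ (congrFun hE' x)
      rw [← hE]
      exact funext fun x => by simp [this]
    simp [ofExpo_coeff, this]
  · simp

/-- An operator commuting with the extended Schur algebra sends `e_β^⊗`, where `β` is injective
on `X`, to a combination of the vectors `e_β^⊗ · σ` with `R(σ) = X`. -/
theorem exists_comp_eq_of_repr_ne_zero {T : Module.End k (⨂[k]^n U)}
    (hT : ∀ ξ, Commute T (schurRep n e ξ)) {X : Finset (Fin n)} {β : X → Fin d}
    (hβ : Function.Injective β) {p : Idx d n}
    (hp : (tensorBasis n e).repr (T (tensorBasis n e ⟨X, β⟩)) p ≠ 0) :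
    ∃ σ : RookMonoid n, σ.range = X ∧ p = ⟨σ.preimage X, RookMonoid.comp β σ⟩ := by
  classical
  by_contra! hne
  apply hp
  -- the idempotent of the weight of `β` fixes `e_β^⊗` and annihilates all other weight spaces
  let ξ : ExtSchurAlgebra k d n := ofExpo k n (Pi.single (expo β β) 1)
  have hξ : schurRep n e ξ (tensorBasis n e ⟨X, β⟩) = tensorBasis n e ⟨X, β⟩ :=
    schurRep_ofExpo_single e hβ β
  have h0 : (tensorBasis n e).coord p ∘ₗ schurRep n e ξ = 0 := by
    refine (tensorBasis n e).ext fun ⟨Y, γ⟩ => ?_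
    rw [LinearMap.comp_apply, schurRep_basis, map_sum]
    refine Finset.sum_eq_zero fun δ _ => ?_
    by_cases h : expo β β = expo δ γ
    · obtain ⟨E, rfl, rfl⟩ := exists_equiv_of_expo_eq h
      have := hne _ (RookMonoid.range_ofEquiv E)
      rw [RookMonoid.comp_ofEquiv] at this
      simp [this.symm]
    · simp [ξ, ofExpo_coeff, Ne.symm h]
  rw [← hξ, ← Module.End.mul_apply, (hT ξ).eq]
  exact LinearMap.congr_fun h0 _

theorem mem_range_rookRep (hnd : n ≤ d) {T : Module.End k (⨂[k]^n U)}
    (hT : T ∈ centralizerAlgebra (schurRep n e)) : T ∈ (rookRep n e).range := by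
  classical
  have := Fintype.ofFinite (RookMonoid n)
  rw [centralizerAlgebra, Subalgebra.mem_centralizer_iff] at hT
  replace hT : ∀ ξ, Commute T (schurRep n e ξ) := fun ξ => (hT _ ⟨ξ, rfl⟩).symm
  -- `b σ` is the index of `e_β^⊗ · σ` and `t σ` its coefficient in `T e_β^⊗`, for `β` the
  -- inclusion of `R(σ)`; composing with the projection onto the block of `R(σ)` keeps `σ` from
  -- acting on the blocks of proper subsets of its range
  let b (σ : RookMonoid n) : Idx d n :=
    ⟨σ.preimage σ.range, RookMonoid.comp (incl hnd σ.range) σ⟩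
  let t (σ : RookMonoid n) : k :=
    (tensorBasis n e).repr (T (tensorBasis n e ⟨σ.range, incl hnd σ.range⟩)) (b σ)
  let S : Module.End k (⨂[k]^n U) := ∑ σ, t σ • (rookOp e σ * blockProj e σ.range)
  have hS : S ∈ (rookRep n e).range := sum_mem fun σ _ =>
    Subalgebra.smul_mem _ (mul_mem (rookOp_mem_range e σ) (blockProj_mem_range e _)) _
  have hST : ∀ X : Finset (Fin n), S (tensorBasis n e ⟨X, incl hnd X⟩) =
      T (tensorBasis n e ⟨X, incl hnd X⟩) := by
    intro X
    refine (tensorBasis n e).ext_elem fun p => ?_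
    have hterm : ∀ σ : RookMonoid n,
        (tensorBasis n e).repr ((t σ • (rookOp e σ * blockProj e σ.range))
          (tensorBasis n e ⟨X, incl hnd X⟩)) p =
        if σ.range = X ∧ b σ = p then t σ else 0 := by
      intro σ
      by_cases hσ : σ.range = X
      · subst hσ
        simp [blockProj_basis, rookOp_basis, Finsupp.single_apply, b]
      · simp [blockProj_basis, hσ, Ne.symm hσ]
    simp only [S, LinearMap.sum_apply, map_sum, Finsupp.finsetSum_apply, hterm]
    by_cases hp : ∃ σ : RookMonoid n, σ.range = X ∧ b σ = p
    · obtain ⟨σ, rfl, rfl⟩ := hp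
      rw [Finset.sum_eq_single σ]
      · simp [t]
      · intro τ _ hτ
        rw [if_neg]
        rintro ⟨h1, h2⟩
        refine hτ (RookMonoid.eq_of_comp_eq (incl_injective hnd σ.range) h1 rfl ?_)
        have hb : ∀ Y, τ.range = Y → b τ = ⟨τ.preimage Y, RookMonoid.comp (incl hnd Y) τ⟩ := by
          rintro _ rfl
          rfl
        exact (hb _ h1).symm.trans h2
      · simp
    · rw [Finset.sum_eq_zero fun σ _ => if_neg fun h => hp ⟨σ, h⟩]
      by_contra h
      obtain ⟨σ, rfl, h⟩ :=
        exists_comp_eq_of_repr_ne_zero e hT (incl_injective hnd X) (Ne.symm h)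
      exact hp ⟨σ, rfl, h.symm⟩
  -- the vectors with injective index generate tensor space over the extended Schur algebra
  suffices S = T from this ▸ hS
  refine (tensorBasis n e).ext fun ⟨X, α⟩ => ?_
  obtain ⟨ξ, hξ⟩ : ∃ ξ, schurRep n e ξ (tensorBasis n e ⟨X, incl hnd X⟩) =
      tensorBasis n e ⟨X, α⟩ := ⟨_, schurRep_ofExpo_single e (incl_injective hnd X) α⟩
  obtain ⟨a, ha⟩ := hS
  have hSξ : Commute S (schurRep n e ξ) := by
    rw [← ha]
    exact (schurRep_rookRep_comm e ξ a).symm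
  rw [← hξ, ← Module.End.mul_apply, hSξ.eq, Module.End.mul_apply, hST, ← Module.End.mul_apply,
    ← (hT ξ).eq, Module.End.mul_apply]

theorem rookRep_injective (hnd : n ≤ d) : Function.Injective (rookRep (k := k) n e) := by
  classical
  rw [injective_iff_map_eq_zero]
  intro a ha
  by_contra hne
  have hsupp : a.unop.coeff.support.Nonempty := by
    rw [Finsupp.support_nonempty_iff]
    intro h
    exact hne (MulOpposite.unop_injective (MonoidAlgebra.coeff_injective h))
  -- at an element of maximal range in the support, exactly one term survives
  obtain ⟨τ, hτ, hmax⟩ := a.unop.coeff.support.exists_max_image (fun σ => σ.range.card) hsupp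
  have h := congrArg (fun v => (tensorBasis n e).repr v
      ⟨τ.preimage τ.range, RookMonoid.comp (incl hnd τ.range) τ⟩)
    (LinearMap.congr_fun ha (tensorBasis n e ⟨τ.range, incl hnd τ.range⟩))
  simp only [rookRep_apply, Finsupp.sum, LinearMap.sum_apply, map_sum, LinearMap.smul_apply,
    map_smul, Finsupp.finsetSum_apply, rookOp_basis, LinearMap.zero_apply, map_zero] at h
  rw [Finset.sum_eq_single_of_mem τ hτ] at h
  · exact Finsupp.mem_support_iff.1 hτ (by simpa using h)
  · intro σ hσ hστ
    split_ifs with hsub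
    · have hr := (Finset.eq_of_subset_of_card_le hsub (hmax σ hσ)).symm
      have := mt (RookMonoid.eq_of_comp_eq (incl_injective hnd τ.range) hr rfl) hστ
      simp [this]
    · simp

end Tensor

end RookSchur

/-- Schur--Weyl duality between the extended Schur algebra and the rook monoid on tensor space. -/
theorem mainTheorem1 {k : Type*} [Field k] [CharZero k] {d n : ℕ} (hnd : n ≤ d)
    {U : Type*} [AddCommGroup U] [Module k U] (e : Module.Basis (Option (Fin d)) k U) :
    (RookSchur.schurRep n e).range = RookSchur.centralizerAlgebra (RookSchur.rookRep n e) ∧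
    (RookSchur.rookRep n e).range = RookSchur.centralizerAlgebra (RookSchur.schurRep n e) ∧
    (∃ Φ : RookSchur.ExtSchurAlgebra k d n ≃ₐ[k]
        RookSchur.centralizerAlgebra (RookSchur.rookRep n e),
      ∀ ξ, (Φ ξ : Module.End k (TensorPower k n U)) = RookSchur.schurRep n e ξ) ∧
    (∃ Ψ : (MonoidAlgebra k (RookSchur.RookMonoid n))ᵐᵒᵖ ≃ₐ[k]
        RookSchur.centralizerAlgebra (RookSchur.schurRep n e),
      ∀ a, (Ψ a : Module.End k (TensorPower k n U)) = RookSchur.rookRep n e a) := by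
  have h1 : (RookSchur.schurRep n e).range =
      RookSchur.centralizerAlgebra (RookSchur.rookRep n e) := by
    refine le_antisymm ?_ fun T hT => RookSchur.mem_range_schurRep e hT
    rintro _ ⟨ξ, rfl⟩
    rw [RookSchur.centralizerAlgebra, Subalgebra.mem_centralizer_iff]
    rintro _ ⟨a, rfl⟩
    exact (RookSchur.schurRep_rookRep_comm e ξ a).symm
  have h2 : (RookSchur.rookRep n e).range =
      RookSchur.centralizerAlgebra (RookSchur.schurRep n e) := by
    refine le_antisymm ?_ fun T hT => RookSchur.mem_range_rookRep e hnd hT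
    rintro _ ⟨a, rfl⟩
    rw [RookSchur.centralizerAlgebra, Subalgebra.mem_centralizer_iff]
    rintro _ ⟨ξ, rfl⟩
    exact RookSchur.schurRep_rookRep_comm e ξ a
  exact ⟨h1, h2,
    ⟨(AlgEquiv.ofInjective _ (RookSchur.schurRep_injective e)).trans
      (Subalgebra.equivOfEq _ _ h1), fun _ => rfl⟩,
    ⟨(AlgEquiv.ofInjective _ (RookSchur.rookRep_injective e hnd)).trans
      (Subalgebra.equivOfEq _ _ h2), fun _ => rfl⟩⟩
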